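/- Let $D\ge 2$, let $\mathcal D$ be the set of density matrices on $\mathbb C^D$, and let $\mathcal M$ be a quantum channel on the complex $D\times D$ matrices, i.e. a completely positive, trace preserving linear map. For a unitary $U$ let $\mathcal I_U\subset\mathcal D$ be the set of states that are diagonal in the basis $|b_j\rangle = U|j\rangle$, let $$C_U(\rho)=\frac1{D-1}\min_{\tau\in\mathcal D}\Big\{s\ge 0 \;\Big|\; \frac{\rho+s\tau}{1+s}\in\mathcal I_U\Big\}$$ be the normalized robustness of coherence, and for $\vec\alpha\in\mathbb R^D$ let $|\Psi_U^{\vec\alpha}\rangle=\frac1{\sqrt D}\sum_j e^{i\alpha_j}|b_j\rangle$ be the maximally coherent states for $U$. Define $$Q_-(\mathcal M)=\min_{U,U'}\max_{\vec\alpha} C_{U'}\big[\mathcal M(|\Psi_U^{\vec\alpha}\rangle\langle\Psi_U^{\vec\alpha}|)\big],\quad Q_0(\mathcal M)=\min_{U}\max_{\vec\alpha} C_{U}\big[\mathcal M(|\Psi_U^{\vec\alpha}\rangle\langle\Psi_U^{\vec\alpha}|)\big],\quad Q_+(\mathcal M)=\min_{U}\max_{\rho\in\mathcal D} C_{U}[\mathcal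 M(\rho)].$$ If $Q_-(\mathcal M)=1$ or $Q_0(\mathcal M)=1$ or $Q_+(\mathcal M)=1$, then $\mathcal M$ is a unitary channel: there is a unitary $V$ with $\mathcal M(\rho)=V\rho V^\dagger$ for all $\rho$. The same holds, with $\min$ and $\max$ read as infimum and supremum, if $C_U$ is replaced by any family of functions $C_U:\mathcal D\to[0,1]$ (one for each unitary $U$), each continuous and convex, such that $C_U(\rho)=1$ exactly when $\rho=|\Psi_U^{\vec\alpha}\rangle\langle\Psi_U^{\vec\alpha}|$ for some $\vec\alpha$. -/

import Mathlib

namespace QuantumMemory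

noncomputable section

/-- Operators on the `D`-dimensional Hilbert space `ℂ ^ D`. -/
abbrev Op (D : ℕ) : Type := Matrix (Fin D) (Fin D) ℂ

/-- Unitary `D × D` matrices. The unitary `U` stands for the orthonormal basis
`|b_j⟩ = U |j⟩` formed by its columns. -/
abbrev Uni (D : ℕ) : Type := Matrix.unitaryGroup (Fin D) ℂ

section Channel

open scoped ComplexOrder Matrix.Norms.L2Operator MatrixOrder

/-- Quantum channels: completely positive, trace preserving linear maps on the `D × D` matrices,
these being ordered by the positive semidefinite cone. -/
structure Channel (D : ℕ) extends CompletelyPositiveMap (Op D) (Op D) where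
  trace_map : ∀ A : Op D, Matrix.trace (toFun A) = Matrix.trace A

end Channel

instance (D : ℕ) : CoeFun (Channel D) (fun _ => Op D → Op D) where
  coe M := M.toFun

/-- `M` is a unitary channel: `M(ρ) = V ρ V†` for some unitary `V`. -/
def Channel.IsUnitary {D : ℕ} (M : Channel D) : Prop :=
  ∃ V : Uni D, ∀ ρ : Op D, M ρ = (V : Op D) * ρ * (V : Op D).conjTranspose

section States

open scoped ComplexOrder

/-- The set of quantum states (density matrices). -/
def states (D : ℕ) : Set (Op D) :=
  {ρ | ρ.PosSemidef ∧ ρ.trace = 1}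

end States

/-- The set of states that are incoherent (diagonal) with respect to the basis `U |j⟩`. -/
def incoherent {D : ℕ} (U : Uni D) : Set (Op D) :=
  {ρ | ρ ∈ states D ∧ ((U : Op D).conjTranspose * ρ * (U : Op D)).IsDiag}

/-- The normalized robustness of coherence of `ρ` with respect to the basis `U |j⟩`. -/
def robustness {D : ℕ} (U : Uni D) (ρ : Op D) : ℝ :=
  1 / ((D : ℝ) - 1) *
    sInf {s : ℝ | 0 ≤ s ∧ ∃ τ ∈ states D, (1 + s)⁻¹ • (ρ + s • τ) ∈ incoherent U}

/-- The vector `D^{-1/2} ∑_j e^{i α_j} |b_j⟩`, where `|b_j⟩ = U |j⟩`. -/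
def maxCohVec {D : ℕ} (U : Uni D) (α : Fin D → ℝ) : Fin D → ℂ :=
  ((Real.sqrt D : ℝ) : ℂ)⁻¹ •
    (U : Op D).mulVec (fun j => Complex.exp ((α j : ℂ) * Complex.I))

/-- The maximally coherent state with phases `α` in the basis `U |j⟩`, as a density matrix. -/
def maxCoh {D : ℕ} (U : Uni D) (α : Fin D → ℝ) : Op D :=
  Matrix.vecMulVec (maxCohVec U α) (star (maxCohVec U α))

/-- `Q₋` with respect to a family `C` of coherence measures, one for each basis `U`. -/
def Qminus {D : ℕ} (C : Uni D → Op D → ℝ) (M : Channel D) : ℝ :=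
  ⨅ UU : Uni D × Uni D, ⨆ α : Fin D → ℝ, C UU.2 (M (maxCoh UU.1 α))

/-- `Q₀` with respect to a family `C` of coherence measures, one for each basis `U`. -/
def Qzero {D : ℕ} (C : Uni D → Op D → ℝ) (M : Channel D) : ℝ :=
  ⨅ U : Uni D, ⨆ α : Fin D → ℝ, C U (M (maxCoh U α))

/-- `Q₊` with respect to a family `C` of coherence measures, one for each basis `U`. -/
def Qplus {D : ℕ} (C : Uni D → Op D → ℝ) (M : Channel D) : ℝ :=
  ⨅ U : Uni D, ⨆ ρ : states D, C U (M ρ)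

/-- The coherence measures, normalized to `[0, 1]`, that may replace the robustness: for each
basis, continuous and convex on states, with maximal value `1`, which is attained exactly at the
maximally coherent states. No further axiom of a coherence measure is imposed. -/
structure IsCoherenceMeasure {D : ℕ} (C : Uni D → Op D → ℝ) : Prop where
  mem_Icc : ∀ U, ∀ ρ ∈ states D, C U ρ ∈ Set.Icc (0 : ℝ) 1
  continuousOn : ∀ U, ContinuousOn (C U) (states D)
  convexOn : ∀ U, ConvexOn ℝ (states D) (C U)
  eq_one_iff : ∀ U, ∀ ρ ∈ states D, C U ρ = 1 ↔ ∃ α : Fin D → ℝ, ρ = maxCoh U α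

end

end QuantumMemory

/-! Each of the three quantities is at most the supremum of `C U (M ρ)` over all states, for every
basis `U`. If one of them is 1, compactness of the state space shows that for every `U` some state
is mapped to a maximally coherent state of `U`, which is pure.

A non-unitary channel has too few pure outputs for this. If `M ρ` is the pure state of `y`, all
Kraus operators send some common `x ≠ 0` into the line of `y`. By linear algebra
(`exists_hyperplanes_or_proportional`), either the Kraus operators are all multiples of one matrix,
and trace preservation makes `M` unitary, or all such `y` lie in two fixed hyperplanes, with normals
`v` and `w`. In the second case `exists_maxCohVec_not_orthogonal` gives a basis none of whose
maximally coherent vectors lies in either hyperplane: take two basis vectors spanning a plane that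
contains `v` and `w`, turned so that neither has coordinates of equal modulus; then `p * exp (i α) +
q * exp (i β)` never vanishes.

For the robustness it remains to verify the axioms. In the basis `U` it is, up to normalization, the
least `tr δ - 1` over real diagonal `δ ≥ ρ`. It is bounded by the absolute sum of the entries minus
1, and equality in Cauchy-Schwarz singles out the maximally coherent states. -/

section LinearAlgebra

/-! ### Linear maps sending a common vector into a common line -/

/-- Let `T i` be linear maps without common kernel. Either they are all multiples of a single map,
or there are two hyperplanes such that every `y` whose line contains all images `T i x` of some
`x ≠ 0` lies in one of them. -/
theorem exists_hyperplanes_or_proportional {K E ι : Type*} [Field K] [AddCommGroup E] [Module K E]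
    [FiniteDimensional K E] [Nontrivial E] (T : ι → E →ₗ[K] E)
    (hT : ∀ x, x ≠ 0 → ∃ i, T i x ≠ 0) :
    (∃ f g : E →ₗ[K] K, f ≠ 0 ∧ g ≠ 0 ∧ ∀ (y x : E) (a : ι → K), x ≠ 0 → (∀ i, T i x = a i • y) →
      f y = 0 ∨ g y = 0) ∨
    ∃ (a : ι → K) (V : E →ₗ[K] E), ∀ i, T i = a i • V := by
  classical
  set X : Set E := {y | ∃ (x : E) (a : ι → K), x ≠ 0 ∧ ∀ i, T i x = a i • y} with hX
  by_cases hspan : Submodule.span K X = ⊤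
  -- When `X` spans, it contains a basis `b`, with `T i (x k) = a k i • b k`, so all `T i` are
  -- diagonal with respect to the pair `x`, `b`.
  · let b := Module.Basis.ofSpan hspan.ge
    have hb : ∀ k, b k ∈ X := fun k => Module.Basis.ofSpan_subset hspan.ge ⟨k, rfl⟩
    choose x a hx0 hx using hb
    have ha0 : ∀ k, ∃ i, a k i ≠ 0 := fun k => by
      obtain ⟨i, hi⟩ := hT _ (hx0 k)
      exact ⟨i, fun h => hi (by rw [hx, h, zero_smul])⟩
    have : Finite _ := Module.Finite.finite_basis b
    have := Fintype.ofFinite ↑((linearIndepOn_empty K id).extend (Set.empty_subset X))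
    -- Some `a k i` is nonzero for each `k`, so applying that `T i` to a relation among the `x`
    -- isolates the coefficient of `x k`.
    have hli : LinearIndependent K x := by
      rw [Fintype.linearIndependent_iff]
      intro c hc k
      obtain ⟨i, hi⟩ := ha0 k
      have h := congrArg (T i) hc
      simp only [map_sum, map_smul, hx, map_zero, smul_smul] at h
      have := (Fintype.linearIndependent_iff.1 b.linearIndependent) _ h k
      exact (mul_eq_zero.1 this).resolve_right hi
    have : Nonempty _ := b.index_nonempty
    let B := basisOfLinearIndependentOfCardEqFinrank hli (Module.finrank_eq_card_basis b).symm
    have hB : ∀ k, B k = x k := fun k => by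
      simp [B]
    -- If the rows `a k` are pairwise proportional, the `T i` are multiples of one map. If `a k` and
    -- `a l` are not, the hyperplanes are the kernels of the coordinates `k` and `l`.
    by_cases hpar : ∀ k l, ∃ r : K, ∀ i, a l i = r * a k i
    · right
      obtain ⟨k⟩ := this
      choose r hr using hpar k
      refine ⟨a k, B.constr K fun l => r l • b l, fun i => B.ext fun l => ?_⟩
      rw [LinearMap.smul_apply, B.constr_basis, hB, hx, hr, smul_smul, mul_comm]
    · left
      push Not at hpar
      obtain ⟨k, l, hkl⟩ := hpar
      refine ⟨b.coord k, b.coord l, ?_, ?_, fun y z c hz hc => ?_⟩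
      · intro h
        simpa using LinearMap.congr_fun h (b k)
      · intro h
        simpa using LinearMap.congr_fun h (b l)
      by_contra! hne
      have key : ∀ m i, B.repr z m * a m i = c i * b.coord m y := fun m i => by
        have h := hc i
        rw [← B.sum_repr z] at h
        simp only [map_sum, map_smul, hB, hx, smul_smul] at h
        have h2 := congrArg (b.coord m) h
        simpa [Finsupp.single_apply] using h2
      obtain ⟨j, hj⟩ := hT z hz
      have hcj : c j ≠ 0 := fun h => hj (by rw [hc, h, zero_smul])
      have hl : B.repr z l ≠ 0 := fun h => by
        have := key l j
        rw [h, zero_mul] at this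
        exact mul_ne_zero hcj hne.2 this.symm
      -- Eliminating `c i` between `key k i` and `key l i` gives this ratio of `a l` to `a k`.
      obtain ⟨i, hi⟩ := hkl ((B.repr z l)⁻¹ * b.coord l y * (b.coord k y)⁻¹ * B.repr z k)
      apply hi
      have h1 := key l i
      have h2 := key k i
      have h3 := hne.1
      field_simp
      linear_combination (b.coord k y) * h1 - (b.coord l y) * h2
  · left
    obtain ⟨f, hf, hle⟩ := Submodule.exists_le_ker_of_lt_top _ (lt_top_iff_ne_top.2 hspan)
    exact ⟨f, f, hf, hf, fun y x a hx h => Or.inl (hle (Submodule.subset_span ⟨x, a, hx, h⟩))⟩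

/-- The abstract setting covers both complex matrices and block matrices with matrix entries. -/
theorem exists_eq_star_mul_self {A : Type*} [NonUnitalCStarAlgebra A] [PartialOrder A]
    [StarOrderedRing A] {a : A} (ha : 0 ≤ a) : ∃ b : A, a = star b * b :=
  CStarAlgebra.nonneg_iff_eq_star_mul_self.mp ha

open scoped ComplexOrder in
theorem Matrix.PosSemidef.exists_eq_conjTranspose_mul_self {n : Type*} [Fintype n] [DecidableEq n]
    {A : Matrix n n ℂ} (hA : A.PosSemidef) : ∃ B : Matrix n n ℂ, A = B.conjTranspose * B := by
  open scoped MatrixOrder Matrix.Norms.L2Operator in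
  exact exists_eq_star_mul_self hA.nonneg

end LinearAlgebra

namespace QuantumMemory

/-! ### Kraus operators from complete positivity -/

section Kraus

open scoped ComplexOrder Matrix.Norms.L2Operator MatrixOrder in
/-- The Choi matrix of a channel, as a matrix of blocks, is a square. -/
theorem Channel.exists_choi_eq {D : ℕ} (M : Channel D) :
    ∃ B : Fin D → Fin D → Op D, ∀ i j,
      M (Matrix.single i j 1) = ∑ k, (B k i).conjTranspose * B k j := by
  rcases Nat.eq_zero_or_pos D with rfl | hD
  · exact ⟨fun _ _ => 0, fun i => i.elim0⟩
  let z : Fin D := ⟨0, hD⟩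
  -- With a single nonzero block row, `star R * R` has the matrix unit `single i j 1` as its block
  -- `(i, j)`, so its image under `M` is the Choi matrix.
  let R : CStarMatrix (Fin D) (Fin D) (Op D) :=
    CStarMatrix.ofMatrix (Matrix.of fun k j => if k = z then Matrix.single z j 1 else 0)
  have hnn := M.map_cstarMatrix_nonneg' D (star R * R) (star_mul_self_nonneg R)
  obtain ⟨B, hB⟩ := exists_eq_star_mul_self hnn
  refine ⟨fun k i => B k i, fun i j => ?_⟩
  have h := congrFun (congrFun hB i) j
  rw [CStarMatrix.map_apply, CStarMatrix.mul_apply, CStarMatrix.mul_apply] at h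
  have h2 : ∑ k, (star R) i k * R k j = Matrix.single i j 1 := by
    rw [Finset.sum_eq_single z]
    · simp [CStarMatrix.star_apply, R, Matrix.star_eq_conjTranspose]
    · intro k _ hk
      simp [R, hk]
    · simp
  rw [h2] at h
  simpa [CStarMatrix.star_apply, Matrix.star_eq_conjTranspose] using h

open scoped ComplexOrder Matrix.Norms.L2Operator MatrixOrder in
/-- Every channel has a Kraus decomposition. -/
theorem Channel.exists_kraus {D : ℕ} (M : Channel D) :
    ∃ K : Fin D × Fin D → Op D, ∀ A, M A = ∑ i, K i * A * (K i).conjTranspose := by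
  obtain ⟨B, hB⟩ := M.exists_choi_eq
  -- Each scalar row `(k, l)` of the square root `B`, conjugated and reshaped into a matrix, is one
  -- Kraus operator.
  refine ⟨fun p => Matrix.of fun x i => star (B p.1 i p.2 x), fun A => ?_⟩
  let F : Op D →ₗ[ℂ] Op D := ∑ p : Fin D × Fin D,
    (LinearMap.mulLeft ℂ (Matrix.of fun x i => star (B p.1 i p.2 x) : Op D)) ∘ₗ
      LinearMap.mulRight ℂ (Matrix.of fun x i => star (B p.1 i p.2 x) : Op D).conjTranspose
  have hF : M.toLinearMap = F := by
    refine (Matrix.stdBasis ℂ (Fin D) (Fin D)).ext fun ⟨i, j⟩ => ?_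
    rw [Matrix.stdBasis_eq_single]
    refine (hB i j).trans ?_
    ext x y
    simp only [F, LinearMap.sum_apply, LinearMap.comp_apply, LinearMap.mulLeft_apply,
      LinearMap.mulRight_apply, Matrix.sum_apply, Fintype.sum_prod_type]
    refine Finset.sum_congr rfl fun k _ => ?_
    rw [Matrix.mul_apply]
    refine Finset.sum_congr rfl fun l _ => ?_
    rw [← Matrix.mul_assoc, Matrix.mul_apply, Finset.sum_eq_single j]
    · simp
    · intro m _ hm
      simp [Matrix.mul_single_apply_of_ne (hbj := hm)]
    · simp
  have := LinearMap.congr_fun hF A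
  refine this.trans ?_
  simp [F, LinearMap.sum_apply, Matrix.mul_assoc]

end Kraus

/-! ### Pure outputs of a channel -/

section PureOutputs

variable {D : ℕ}

theorem mul_vecMulVec_mul_conjTranspose (K : Op D) (x : Fin D → ℂ) :
    K * Matrix.vecMulVec x (star x) * K.conjTranspose =
      Matrix.vecMulVec (K.mulVec x) (star (K.mulVec x)) := by
  rw [Matrix.mul_vecMulVec, Matrix.vecMulVec_mul, Matrix.star_mulVec]

-- Otherwise the projector on `x` would be mapped to zero and lose its trace.
open scoped ComplexOrder in
theorem exists_kraus_mulVec_ne_zero {ι : Type*} [Fintype ι] (M : Channel D) {K : ι → Op D}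
    (hK : ∀ A, M A = ∑ i, K i * A * (K i).conjTranspose) {x : Fin D → ℂ} (hx : x ≠ 0) :
    ∃ i, (K i).mulVec x ≠ 0 := by
  by_contra! h
  have ht := M.trace_map (Matrix.vecMulVec x (star x))
  have h1 : M (Matrix.vecMulVec x (star x)) = 0 := by
    rw [hK]
    refine Finset.sum_eq_zero fun i _ => ?_
    rw [mul_vecMulVec_mul_conjTranspose, h, Matrix.zero_vecMulVec]
  erw [h1] at ht
  rw [Matrix.trace_zero, Matrix.trace_vecMulVec] at ht
  exact hx (dotProduct_self_star_eq_zero.1 ht.symm)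

open scoped ComplexOrder in
/-- If a channel maps some state to a pure state, then all its Kraus operators map some nonzero
vector to the line of that pure state. -/
theorem exists_kraus_mulVec_eq_smul {ι : Type*} [Fintype ι] (M : Channel D) {K : ι → Op D}
    (hK : ∀ A, M A = ∑ i, K i * A * (K i).conjTranspose) {ρ : Op D} (hρ : ρ ∈ states D)
    {y : Fin D → ℂ} (hy : M ρ = Matrix.vecMulVec y (star y)) :
    ∃ (x : Fin D → ℂ) (a : ι → ℂ), x ≠ 0 ∧ ∀ i, (K i).mulVec x = a i • y := by
  obtain ⟨B, rfl⟩ := hρ.1.exists_eq_conjTranspose_mul_self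
  have hyy : star y ⬝ᵥ y = 1 := by
    have ht := M.trace_map (B.conjTranspose * B)
    erw [hy] at ht
    rw [Matrix.trace_vecMulVec, hρ.2, dotProduct_comm] at ht
    exact ht
  set P : Op D := 1 - Matrix.vecMulVec y (star y) with hP
  have hPy : P.mulVec y = 0 := by
    rw [hP, Matrix.sub_mulVec, Matrix.one_mulVec, Matrix.vecMulVec_mulVec, hyy]
    simp
  -- Compressing `M ρ` by the projection `P` off the line of `y` gives zero. It is a sum of positive
  -- terms, so each `P * K i * B†` vanishes, and any nonzero column of `B†` serves as `x`.
  have h0 : ∑ i, (P * K i * B.conjTranspose) * (P * K i * B.conjTranspose).conjTranspose = 0 := by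
    have : P * M (B.conjTranspose * B) * P.conjTranspose = 0 := by
      rw [hy, mul_vecMulVec_mul_conjTranspose, hPy, Matrix.zero_vecMulVec]
    rw [hK, Finset.mul_sum, Finset.sum_mul] at this
    rw [← this]
    refine Finset.sum_congr rfl fun i _ => ?_
    simp only [Matrix.conjTranspose_mul, Matrix.conjTranspose_conjTranspose, Matrix.mul_assoc]
  have hz : ∀ i, P * K i * B.conjTranspose = 0 := fun i => by
    have ht := congrArg Matrix.trace h0
    rw [Matrix.trace_sum, Matrix.trace_zero, Finset.sum_eq_zero_iff_of_nonneg fun i _ =>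
      (Matrix.posSemidef_self_mul_conjTranspose _).trace_nonneg] at ht
    exact Matrix.trace_mul_conjTranspose_self_eq_zero_iff.1 (ht i (Finset.mem_univ i))
  have hB : B.conjTranspose ≠ 0 := fun h => by
    have := hρ.2
    rw [h, Matrix.zero_mul, Matrix.trace_zero] at this
    exact zero_ne_one this
  obtain ⟨l, hl⟩ : ∃ l, B.conjTranspose.col l ≠ 0 := by
    by_contra! h
    exact hB (by ext i j; exact congrFun (h j) i)
  refine ⟨B.conjTranspose.col l, fun i => star y ⬝ᵥ (K i).mulVec (B.conjTranspose.col l), hl,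
    fun i => ?_⟩
  have h1 : (P * K i * B.conjTranspose).col l = 0 := by
    rw [hz]; rfl
  have h2 : (P * K i * B.conjTranspose).col l =
      P.mulVec ((K i).mulVec (B.conjTranspose.col l)) := by
    rw [Matrix.mulVec_mulVec]
    rfl
  rw [h2, hP, Matrix.sub_mulVec, Matrix.one_mulVec, Matrix.vecMulVec_mulVec, sub_eq_zero] at h1
  exact h1.trans (by simp)

/-- The single operator `W = √(∑ ‖a i‖²) • V` implements the channel. Trace preservation reads `tr
(W† W A) = tr A` for all `A`, hence `W† W = 1`. -/
theorem Channel.isUnitary_of_kraus_eq_smul {ι : Type*} [Fintype ι] (M : Channel D) {K : ι → Op D}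
    (hK : ∀ A, M A = ∑ i, K i * A * (K i).conjTranspose) {a : ι → ℂ} {V : Op D}
    (h : ∀ i, K i = a i • V) : M.IsUnitary := by
  set c : ℝ := ∑ i, ‖a i‖ ^ 2 with hc
  have hc0 : 0 ≤ c := Finset.sum_nonneg fun i _ => sq_nonneg _
  set W : Op D := ((Real.sqrt c : ℝ) : ℂ) • V with hW
  have hM : ∀ A, M A = W * A * W.conjTranspose := fun A => by
    rw [hK, hW]
    simp only [h, Matrix.conjTranspose_smul, Matrix.smul_mul, Matrix.mul_smul, smul_smul,
      ← Finset.sum_smul]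
    congr 1
    have : ((Real.sqrt c : ℝ) : ℂ) * ((Real.sqrt c : ℝ) : ℂ) = c := by
      rw [← Complex.ofReal_mul, Real.mul_self_sqrt hc0]
    rw [Complex.star_def, Complex.conj_ofReal, this, hc, Complex.ofReal_sum]
    refine Finset.sum_congr rfl fun i _ => ?_
    rw [mul_comm, Complex.mul_conj, Complex.normSq_eq_norm_sq]
  have hWW : W.conjTranspose * W = 1 := by
    refine Matrix.ext_iff_trace_mul_right.2 fun A => ?_
    have := M.trace_map A
    erw [hM A] at this
    rw [Matrix.one_mul, ← this, Matrix.trace_mul_comm (W * A), Matrix.mul_assoc]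
  exact ⟨⟨W, Matrix.mem_unitaryGroup_iff'.2 hWW⟩, hM⟩

/-- The pure outputs of a channel that is not unitary lie in two hyperplanes. -/
theorem Channel.isUnitary_or_exists_hyperplanes (hD : 0 < D) (M : Channel D) :
    M.IsUnitary ∨ ∃ v w : Fin D → ℂ, v ≠ 0 ∧ w ≠ 0 ∧ ∀ ρ ∈ states D, ∀ y : Fin D → ℂ,
      M ρ = Matrix.vecMulVec y (star y) → star v ⬝ᵥ y = 0 ∨ star w ⬝ᵥ y = 0 := by
  obtain ⟨K, hK⟩ := M.exists_kraus
  have : Nonempty (Fin D) := ⟨⟨0, hD⟩⟩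
  have hrep : ∀ f : (Fin D → ℂ) →ₗ[ℂ] ℂ, ∃ v : Fin D → ℂ, ∀ y, f y = star v ⬝ᵥ y := fun f =>
    ⟨star fun i => f (Pi.single i 1), fun y => by
      rw [star_star, LinearMap.pi_apply_eq_sum_univ f y]
      simp only [dotProduct, smul_eq_mul]
      refine Finset.sum_congr rfl fun i _ => ?_
      rw [mul_comm]
      congr 2
      ext j
      simp [Pi.single_apply, eq_comm]⟩
  rcases exists_hyperplanes_or_proportional (fun i => Matrix.mulVecLin (K i))
    (fun x hx => exists_kraus_mulVec_ne_zero M hK hx) with ⟨f, g, hf, hg, h⟩ | ⟨a, V, h⟩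
  · right
    obtain ⟨v, hv⟩ := hrep f
    obtain ⟨w, hw⟩ := hrep g
    refine ⟨v, w, ?_, ?_, fun ρ hρ y hy => ?_⟩
    · rintro rfl
      exact hf (LinearMap.ext fun y => by rw [hv]; simp)
    · rintro rfl
      exact hg (LinearMap.ext fun y => by rw [hw]; simp)
    · obtain ⟨x, a, hx, hxa⟩ := exists_kraus_mulVec_eq_smul M hK hρ hy
      rw [← hv, ← hw]
      exact h y x a hx hxa
  · left
    refine M.isUnitary_of_kraus_eq_smul hK (a := a) (V := LinearMap.toMatrix' V) fun i => ?_
    rw [← map_smul, ← h, ← Matrix.toLin'_apply', LinearMap.toMatrix'_toLin']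

end PureOutputs

end QuantumMemory

/-! ### Orthonormal bases of a plane containing two vectors -/

section OrthonormalPair

variable {E : Type*} [NormedAddCommGroup E] [InnerProductSpace ℂ E] [FiniteDimensional ℂ E]

/-- Normalize the component of `w` orthogonal to `e`. If it is zero, the dimension bound supplies
another direction orthogonal to `e`. -/
theorem exists_unit_orthogonal_eq_smul_add_smul (hE : 2 ≤ Module.finrank ℂ E) {e : E}
    (he : ‖e‖ = 1) (w : E) :
    ∃ f : E, ‖f‖ = 1 ∧ inner ℂ e f = 0 ∧ ∃ c s : ℂ, w = c • e + s • f := by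
  have hne : ∃ z : E, z ≠ 0 ∧ inner ℂ e z = 0 ∧ ∃ c s : ℂ, w = c • e + s • z := by
    by_cases hw : w - (inner ℂ e w : ℂ) • e = 0
    · have h1 := Submodule.finrank_add_finrank_orthogonal (ℂ ∙ e)
      rw [finrank_span_singleton (by rintro rfl; simp at he)] at h1
      obtain ⟨z, hz, hz0⟩ := Submodule.exists_mem_ne_zero_of_ne_bot
        (p := (ℂ ∙ e)ᗮ) (by rintro h; rw [h, finrank_bot] at h1; omega)
      exact ⟨z, hz0, Submodule.mem_orthogonal_singleton_iff_inner_right.1 hz, inner ℂ e w, 0,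
        by rw [zero_smul, add_zero]; exact sub_eq_zero.1 hw⟩
    · refine ⟨_, hw, ?_, inner ℂ e w, 1, by simp⟩
      rw [inner_sub_right, inner_smul_right, inner_self_eq_norm_sq_to_K, he]
      simp
  obtain ⟨z, hz, hez, c, s, hw⟩ := hne
  refine ⟨((‖z‖ : ℂ)⁻¹) • z, ?_, ?_, c, s * ‖z‖, ?_⟩
  · rw [norm_smul, norm_inv, Complex.norm_real, norm_norm, inv_mul_cancel₀ (norm_ne_zero_iff.2 hz)]
  · rw [inner_smul_right, hez, mul_zero]
  · have : (‖z‖ : ℂ) ≠ 0 := by exact_mod_cast norm_ne_zero_iff.2 hz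
    rw [smul_smul, mul_assoc, mul_inv_cancel₀ this, mul_one, hw]

/-- Two nonzero vectors lie in a common plane with an orthonormal basis in which neither of them has
coordinates of equal modulus. -/
theorem exists_orthonormal_pair_norm_coord_ne (hE : 2 ≤ Module.finrank ℂ E) {v w : E} (hv : v ≠ 0)
    (hw : w ≠ 0) :
    ∃ e f : E, ‖e‖ = 1 ∧ ‖f‖ = 1 ∧ inner ℂ e f = 0 ∧
      (∃ p q : ℂ, v = p • e + q • f ∧ ‖p‖ ≠ ‖q‖) ∧ ∃ p q : ℂ, w = p • e + q • f ∧ ‖p‖ ≠ ‖q‖ := by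
  have hnv : (‖v‖ : ℂ) ≠ 0 := by exact_mod_cast norm_ne_zero_iff.2 hv
  set e : E := ((‖v‖ : ℂ)⁻¹) • v with he
  have he1 : ‖e‖ = 1 := by
    rw [he, norm_smul, norm_inv, Complex.norm_real, norm_norm,
      inv_mul_cancel₀ (norm_ne_zero_iff.2 hv)]
  have hve : v = (‖v‖ : ℂ) • e := by rw [he, smul_smul, mul_inv_cancel₀ hnv, one_smul]
  obtain ⟨f, hf, hef, c, s, hwc⟩ := exists_unit_orthogonal_eq_smul_add_smul hE he1 w
  -- In the bad case a phase on `f` makes `w` a multiple of `e + g`. Rotating by the 3-4-5 angle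
  -- gives `v` coordinates proportional to `(3, -4)` and `w` coordinates proportional to `(7, -1)`.
  by_cases hcs : ‖c‖ = ‖s‖
  · have hc : c ≠ 0 := by
      rintro rfl
      rw [norm_zero, eq_comm, norm_eq_zero] at hcs
      exact hw (by rw [hwc, hcs]; simp)
    set g : E := (s / c) • f with hg
    have hg1 : ‖g‖ = 1 := by
      rw [hg, norm_smul, norm_div, hf, ← hcs, div_self (norm_ne_zero_iff.2 hc), one_mul]
    have heg : inner ℂ e g = 0 := by rw [hg, inner_smul_right, hef, mul_zero]
    have hge : inner ℂ g e = 0 := inner_eq_zero_symm.1 heg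
    have hee : inner ℂ e e = (1 : ℂ) := by rw [inner_self_eq_norm_sq_to_K, he1]; simp
    have hgg : inner ℂ g g = (1 : ℂ) := by rw [inner_self_eq_norm_sq_to_K, hg1]; simp
    have hwg : w = c • e + c • g := by
      rw [hwc, hg, smul_smul c (s / c), mul_div_cancel₀ _ hc]
    have unit : ∀ z : E, inner ℂ z z = (1 : ℂ) → ‖z‖ = 1 := fun z hz => by
      rw [inner_self_eq_norm_sq_to_K] at hz
      have hz' : ‖z‖ ^ 2 = 1 := Complex.ofReal_injective (by simpa using hz)
      exact (pow_eq_one_iff_of_nonneg (norm_nonneg z) two_ne_zero).1 hz'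
    refine ⟨(3 / 5 : ℂ) • e + (4 / 5 : ℂ) • g, (-4 / 5 : ℂ) • e + (3 / 5 : ℂ) • g,
      unit _ ?_, unit _ ?_, ?_, ⟨‖v‖ * (3 / 5), ‖v‖ * (-4 / 5), ?_, ?_⟩,
      ⟨c * (7 / 5), c * (-1 / 5), ?_, ?_⟩⟩
    · simp only [inner_add_left, inner_add_right, inner_smul_left, inner_smul_right, heg, hge, hee,
        hgg, map_div₀, map_ofNat]
      norm_num
    · simp only [inner_add_left, inner_add_right, inner_smul_left, inner_smul_right, heg, hge, hee,
        hgg, map_div₀, map_neg, map_ofNat]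
      norm_num
    · simp only [inner_add_left, inner_add_right, inner_smul_left, inner_smul_right, heg, hge, hee,
        hgg, map_div₀, map_ofNat]
      norm_num
    · conv_lhs => rw [hve]
      module
    · rw [norm_mul, norm_mul]
      norm_num
      exact hv
    · rw [hwg]
      module
    · rw [norm_mul, norm_mul]
      norm_num
      exact hc
  · refine ⟨e, f, he1, hf, hef, ⟨‖v‖, 0, by rw [zero_smul, add_zero]; exact hve, ?_⟩,
      c, s, hwc, hcs⟩
    simpa using hv

end OrthonormalPair

/-! ### A basis whose maximally coherent vectors avoid two hyperplanes -/

namespace QuantumMemory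

variable {D : ℕ}

theorem star_dotProduct_maxCohVec (U : Uni D) (α : Fin D → ℝ) (v : Fin D → ℂ) :
    star v ⬝ᵥ maxCohVec U α = ((Real.sqrt D : ℝ) : ℂ)⁻¹ *
      ∑ j, (star v ⬝ᵥ (U : Op D).col j) * Complex.exp ((α j : ℂ) * Complex.I) := by
  rw [maxCohVec, dotProduct_smul, smul_eq_mul, Matrix.dotProduct_mulVec]
  rfl

/-- In a suitable basis no maximally coherent vector is orthogonal to either of two given nonzero
vectors. -/
theorem exists_maxCohVec_not_orthogonal (hD : 2 ≤ D) {v w : Fin D → ℂ} (hv : v ≠ 0) (hw : w ≠ 0) :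
    ∃ U : Uni D, ∀ α, star v ⬝ᵥ maxCohVec U α ≠ 0 ∧ star w ⬝ᵥ maxCohVec U α ≠ 0 := by
  obtain ⟨e, f, he, hf, hef, ⟨p, q, hv', hpq⟩, r, t, hw', hrt⟩ :=
    exists_orthonormal_pair_norm_coord_ne (E := EuclideanSpace ℂ (Fin D)) (by simpa using hD)
      (v := WithLp.toLp 2 v) (w := WithLp.toLp 2 w) (by simpa using hv) (by simpa using hw)
  let i₀ : Fin D := ⟨0, by omega⟩
  let i₁ : Fin D := ⟨1, by omega⟩
  have hi : i₁ ≠ i₀ := by simp [i₀, i₁]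
  have hon : Orthonormal ℂ (({i₀, i₁} : Set (Fin D)).domRestrict fun i => if i = i₀ then e else f) := by
    constructor
    · rintro ⟨i, hi'⟩
      change ‖if i = i₀ then e else f‖ = 1
      split_ifs <;> assumption
    · rintro ⟨i, hi'⟩ ⟨j, hj'⟩ hij
      have hij' : i ≠ j := fun h => hij (Subtype.ext h)
      change inner ℂ (if i = i₀ then e else f) (if j = i₀ then e else f) = 0
      simp only [Set.mem_insert_iff, Set.mem_singleton_iff] at hi' hj'
      rcases hi' with rfl | rfl <;> rcases hj' with rfl | rfl
      · exact absurd rfl hij'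
      · rw [if_pos rfl, if_neg hi, hef]
      · rw [if_pos rfl, if_neg hi, inner_eq_zero_symm.1 hef]
      · exact absurd rfl hij'
  obtain ⟨b, hb⟩ := hon.exists_orthonormalBasis_extension_of_card_eq (by simp)
  have hb0 : b i₀ = e := by simpa using hb i₀ (by simp)
  have hb1 : b i₁ = f := by simpa [hi] using hb i₁ (by simp)
  let U : Uni D := ⟨(EuclideanSpace.basisFun (Fin D) ℂ).toBasis.toMatrix b,
    (EuclideanSpace.basisFun (Fin D) ℂ).toMatrix_orthonormalBasis_mem_unitary b⟩
  have key : ∀ (u : Fin D → ℂ) (p q : ℂ), WithLp.toLp 2 u = p • e + q • f → ‖p‖ ≠ ‖q‖ →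
      ∀ α, star u ⬝ᵥ maxCohVec U α ≠ 0 := by
    intro u p q hu hpq α h
    -- Only the columns `i₀` and `i₁` of `U` meet `u`, so two phases survive in the overlap.
    have hcol : ∀ j, star u ⬝ᵥ (U : Op D).col j =
        (starRingEnd ℂ p) * (if i₀ = j then 1 else 0) +
          (starRingEnd ℂ q) * (if i₁ = j then 1 else 0) := fun j => by
      have h1 : star u ⬝ᵥ (U : Op D).col j = inner ℂ (WithLp.toLp 2 u) (b j) := by
        rw [EuclideanSpace.inner_eq_star_dotProduct, dotProduct_comm]
        rfl
      rw [h1, hu, inner_add_left, inner_smul_left, inner_smul_left, ← hb0, ← hb1,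
        orthonormal_iff_ite.1 b.orthonormal, orthonormal_iff_ite.1 b.orthonormal]
    rw [star_dotProduct_maxCohVec] at h
    have hD0 : ((Real.sqrt D : ℝ) : ℂ) ≠ 0 := by
      rw [Complex.ofReal_ne_zero, Real.sqrt_ne_zero (Nat.cast_nonneg D)]
      exact_mod_cast (by omega : D ≠ 0)
    have h2 := (mul_eq_zero.1 h).resolve_left (inv_ne_zero hD0)
    simp only [hcol, add_mul, Finset.sum_add_distrib, mul_ite, mul_one, mul_zero, ite_mul, zero_mul,
      Finset.sum_ite_eq, Finset.mem_univ, if_true] at h2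
    have h3 := congrArg norm (eq_neg_of_add_eq_zero_left h2)
    rw [norm_neg, norm_mul, norm_mul, Complex.norm_exp_ofReal_mul_I, Complex.norm_exp_ofReal_mul_I,
      mul_one, mul_one, RCLike.norm_conj, RCLike.norm_conj] at h3
    exact hpq h3
  exact ⟨U, fun α => ⟨key v p q hv' hpq α, key w r t hw' hrt α⟩⟩

theorem Channel.isUnitary_of_forall_maxCoh (hD : 2 ≤ D) (M : Channel D)
    (h : ∀ U : Uni D, ∃ ρ ∈ states D, ∃ α, M ρ = maxCoh U α) : M.IsUnitary := by
  rcases M.isUnitary_or_exists_hyperplanes (by omega) with hM | ⟨v, w, hv, hw, hvw⟩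
  · exact hM
  · obtain ⟨U, hU⟩ := exists_maxCohVec_not_orthogonal hD hv hw
    obtain ⟨ρ, hρ, α, hα⟩ := h U
    exact ((hvw ρ hρ _ hα).elim (hU α).1 (hU α).2).elim

/-! ### Compactness of the state space -/

section States

-- The states are the image of the Frobenius unit sphere under `A ↦ A† A`.
open scoped ComplexOrder in
theorem isCompact_states (D : ℕ) : IsCompact (states D) := by
  let S : Set (Op D) := {A | (A.conjTranspose * A).trace = 1}
  have hnorm : ∀ A : Op D, (A.conjTranspose * A).trace = ((∑ i, ∑ j, ‖A j i‖ ^ 2 : ℝ) : ℂ) := by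
    intro A
    simp only [Matrix.trace, Matrix.diag, Matrix.mul_apply, Matrix.conjTranspose_apply,
      Complex.ofReal_sum]
    refine Finset.sum_congr rfl fun i _ => Finset.sum_congr rfl fun j _ => ?_
    rw [Complex.star_def, mul_comm, Complex.mul_conj, Complex.normSq_eq_norm_sq]
  have hS : IsCompact S := by
    have hcl : IsClosed S := isClosed_eq (by fun_prop) continuous_const
    refine IsCompact.of_isClosed_subset
      (isCompact_univ_pi fun _ : Fin D => isCompact_univ_pi fun _ : Fin D =>
        isCompact_closedBall (0 : ℂ) 1) hcl ?_
    intro A hA j _ i _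
    rw [mem_closedBall_zero_iff]
    have h1 : ∑ i, ∑ j, ‖A j i‖ ^ 2 = 1 := by
      have := (hnorm A).symm.trans hA
      exact_mod_cast this
    have h2 : ‖A j i‖ ^ 2 ≤ 1 := by
      rw [← h1]
      refine (Finset.single_le_sum (f := fun j => ‖A j i‖ ^ 2) (fun _ _ => sq_nonneg _)
        (Finset.mem_univ j)).trans ?_
      exact Finset.single_le_sum (f := fun i => ∑ j, ‖A j i‖ ^ 2)
        (fun _ _ => Finset.sum_nonneg fun _ _ => sq_nonneg _) (Finset.mem_univ i)
    exact (pow_le_one_iff_of_nonneg (norm_nonneg _) two_ne_zero).1 h2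
  have himg : states D = (fun A : Op D => A.conjTranspose * A) '' S := by
    ext ρ
    constructor
    · rintro ⟨hρ, ht⟩
      obtain ⟨B, rfl⟩ := hρ.exists_eq_conjTranspose_mul_self
      exact ⟨B, ht, rfl⟩
    · rintro ⟨A, hA, rfl⟩
      exact ⟨Matrix.posSemidef_conjTranspose_mul_self A, hA⟩
  rw [himg]
  exact hS.image (by fun_prop)

open scoped ComplexOrder in
theorem Channel.map_mem_states (M : Channel D) {ρ : Op D} (hρ : ρ ∈ states D) : M ρ ∈ states D := by
  refine ⟨?_, (M.trace_map ρ).trans hρ.2⟩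
  obtain ⟨K, hK⟩ := M.exists_kraus
  rw [hK]
  exact Matrix.posSemidef_sum _ fun i _ => hρ.1.mul_mul_conjTranspose_same _

theorem Channel.continuous (M : Channel D) : Continuous (M : Op D → Op D) := by
  obtain ⟨K, hK⟩ := M.exists_kraus
  rw [show (M : Op D → Op D) = _ from funext hK]
  fun_prop

theorem star_maxCohVec_dotProduct_self (hD : 0 < D) (U : Uni D) (α : Fin D → ℝ) :
    star (maxCohVec U α) ⬝ᵥ maxCohVec U α = 1 := by
  have hD0 : (D : ℂ) ≠ 0 := by exact_mod_cast hD.ne'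
  have hs : ((Real.sqrt D : ℝ) : ℂ) * ((Real.sqrt D : ℝ) : ℂ) = D := by
    rw [← Complex.ofReal_mul, Real.mul_self_sqrt (Nat.cast_nonneg D), Complex.ofReal_natCast]
  have hUU : (U : Op D).conjTranspose * (U : Op D) = 1 := Matrix.mem_unitaryGroup_iff'.1 U.2
  have hsum : star (fun j => Complex.exp ((α j : ℂ) * Complex.I)) ⬝ᵥ
      (fun j => Complex.exp ((α j : ℂ) * Complex.I)) = (D : ℂ) := by
    have : ∀ j, star (Complex.exp ((α j : ℂ) * Complex.I)) * Complex.exp ((α j : ℂ) * Complex.I)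
        = 1 := fun j => by
      rw [Complex.star_def, mul_comm, Complex.mul_conj, Complex.normSq_eq_norm_sq,
        Complex.norm_exp_ofReal_mul_I]
      simp
    simp only [dotProduct, Pi.star_apply, this]
    simp
  rw [maxCohVec, star_smul, smul_dotProduct, dotProduct_smul, Matrix.star_mulVec,
    ← Matrix.dotProduct_mulVec, Matrix.mulVec_mulVec, hUU, Matrix.one_mulVec, hsum, star_inv₀,
    Complex.star_def, Complex.conj_ofReal, smul_eq_mul, smul_eq_mul, ← mul_assoc, ← mul_inv, hs,
    inv_mul_cancel₀ hD0]

open scoped ComplexOrder in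
theorem maxCoh_mem_states (hD : 0 < D) (U : Uni D) (α : Fin D → ℝ) : maxCoh U α ∈ states D := by
  refine ⟨Matrix.posSemidef_vecMulVec_self_star _, ?_⟩
  rw [maxCoh, Matrix.trace_vecMulVec, dotProduct_comm, star_maxCohVec_dotProduct_self hD]

end States

/-! ### From the extremal values to attained maxima -/

section Quantifiers

variable {C : Uni D → Op D → ℝ}

/-- By continuity and compactness the supremum is attained, and there the measure equals 1. -/
theorem IsCoherenceMeasure.exists_eq_maxCoh (hC : IsCoherenceMeasure C) (hD : 0 < D)
    (M : Channel D) (U : Uni D) (h : 1 ≤ ⨆ ρ : states D, C U (M ρ)) :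
    ∃ ρ ∈ states D, ∃ α, M ρ = maxCoh U α := by
  have hne : (states D).Nonempty := ⟨_, maxCoh_mem_states hD U 0⟩
  have : Nonempty (states D) := hne.to_subtype
  obtain ⟨ρ, hρ, hmax⟩ := (isCompact_states D).exists_isMaxOn hne
    ((hC.continuousOn U).comp M.continuous.continuousOn fun ρ hρ => M.map_mem_states hρ)
  refine ⟨ρ, hρ, (hC.eq_one_iff U _ (M.map_mem_states hρ)).1 (le_antisymm ?_ ?_)⟩
  · exact (hC.mem_Icc U _ (M.map_mem_states hρ)).2
  · exact h.trans (ciSup_le fun σ => hmax σ.2)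

theorem IsCoherenceMeasure.bddAbove_states (hC : IsCoherenceMeasure C) (M : Channel D)
    (U : Uni D) : BddAbove (Set.range fun ρ : states D => C U (M ρ)) :=
  ⟨1, by rintro _ ⟨ρ, rfl⟩; exact (hC.mem_Icc U _ (M.map_mem_states ρ.2)).2⟩

theorem IsCoherenceMeasure.iSup_maxCoh_le (hC : IsCoherenceMeasure C) (hD : 0 < D)
    (M : Channel D) (U U' : Uni D) :
    ⨆ α, C U' (M (maxCoh U α)) ≤ ⨆ ρ : states D, C U' (M ρ) :=
  ciSup_le fun α => le_ciSup (hC.bddAbove_states M U') ⟨_, maxCoh_mem_states hD U α⟩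

theorem IsCoherenceMeasure.iSup_maxCoh_nonneg (hC : IsCoherenceMeasure C) (hD : 0 < D)
    (M : Channel D) (U U' : Uni D) : 0 ≤ ⨆ α, C U' (M (maxCoh U α)) :=
  Real.iSup_nonneg fun α =>
    (hC.mem_Icc U' _ (M.map_mem_states (maxCoh_mem_states hD U α))).1

theorem IsCoherenceMeasure.isUnitary (hC : IsCoherenceMeasure C) (hD : 2 ≤ D) (M : Channel D)
    (h : Qminus C M = 1 ∨ Qzero C M = 1 ∨ Qplus C M = 1) : M.IsUnitary := by
  have hD0 : 0 < D := by omega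
  refine M.isUnitary_of_forall_maxCoh hD fun U => hC.exists_eq_maxCoh hD0 M U ?_
  rcases h with h | h | h
  · rw [← h]
    -- The two bases of `Qminus` may be taken equal.
    refine le_trans (ciInf_le ⟨0, ?_⟩ ((U, U) : Uni D × Uni D)) (hC.iSup_maxCoh_le hD0 M U U)
    rintro _ ⟨UU, rfl⟩
    exact hC.iSup_maxCoh_nonneg hD0 M _ _
  · rw [← h]
    refine le_trans (ciInf_le ⟨0, ?_⟩ U) (hC.iSup_maxCoh_le hD0 M U U)
    rintro _ ⟨U, rfl⟩
    exact hC.iSup_maxCoh_nonneg hD0 M _ _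
  · rw [← h]
    refine ciInf_le ⟨0, ?_⟩ U
    rintro _ ⟨U, rfl⟩
    exact Real.iSup_nonneg fun ρ => (hC.mem_Icc U _ (M.map_mem_states ρ.2)).1

end Quantifiers

/-! ### Domination of a state by diagonal matrices -/

section Domination

open scoped ComplexOrder

variable {D : ℕ}

/-- The numbers `tr δ - 1` for the real diagonal matrices `δ` that dominate `σ`. -/
def dominationSet (σ : Op D) : Set ℝ :=
  {s | ∃ d : Fin D → ℝ, (Matrix.diagonal (fun j => (d j : ℂ)) - σ).PosSemidef ∧ ∑ j, d j = 1 + s}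

theorem trace_diagonal_ofReal_sub (d : Fin D → ℝ) (σ : Op D) :
    (Matrix.diagonal (fun j => (d j : ℂ)) - σ).trace = ((∑ j, d j : ℝ) : ℂ) - σ.trace := by
  rw [Matrix.trace_sub, Matrix.trace_diagonal, Complex.ofReal_sum]

theorem nonneg_of_mem_dominationSet {σ : Op D} (hσ : σ ∈ states D) {s : ℝ}
    (hs : s ∈ dominationSet σ) : 0 ≤ s := by
  obtain ⟨d, hd, hsum⟩ := hs
  have h := hd.trace_nonneg
  rw [trace_diagonal_ofReal_sub, hsum, hσ.2] at h
  have : (0 : ℂ) ≤ ((s : ℝ) : ℂ) := by simpa using h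
  exact Complex.zero_le_real.1 this

theorem bddBelow_dominationSet {σ : Op D} (hσ : σ ∈ states D) : BddBelow (dominationSet σ) :=
  ⟨0, fun _ hs => nonneg_of_mem_dominationSet hσ hs⟩

/-- A Hermitian matrix is dominated by the diagonal matrix of its absolute column sums. -/
theorem posSemidef_diagonal_sum_norm_sub {H : Op D} (hH : H.IsHermitian) :
    (Matrix.diagonal (fun j => ((∑ i, ‖H i j‖ : ℝ) : ℂ)) - H).PosSemidef := by
  have hsymm : ∀ i j, ‖H i j‖ = ‖H j i‖ := fun i j => by
    rw [← hH.apply i j, norm_star]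
  have hdiag : (Matrix.diagonal (fun j => ((∑ i, ‖H i j‖ : ℝ) : ℂ)) : Op D).IsHermitian := by
    refine Matrix.isHermitian_diagonal_of_self_adjoint _ ?_
    ext j
    simp
  have hherm := hdiag.sub hH
  refine Matrix.PosSemidef.of_dotProduct_mulVec_nonneg hherm fun x => ?_
  have him : (star x ⬝ᵥ
      (Matrix.diagonal (fun j => ((∑ i, ‖H i j‖ : ℝ) : ℂ)) - H).mulVec x).im = 0 :=
    hherm.im_star_dotProduct_mulVec_self x
  have hre : 0 ≤ (star x ⬝ᵥ
      (Matrix.diagonal (fun j => ((∑ i, ‖H i j‖ : ℝ) : ℂ)) - H).mulVec x).re := by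
    rw [Matrix.sub_mulVec, dotProduct_sub, Complex.sub_re, sub_nonneg]
    -- Use `‖x i‖ * ‖x j‖ ≤ (‖x i‖² + ‖x j‖²) / 2`; the symmetry of `‖H i j‖` then merges the two
    -- halves.
    have h1 : (star x ⬝ᵥ H.mulVec x).re ≤ ∑ i, ∑ j, ‖H i j‖ * ((‖x i‖ ^ 2 + ‖x j‖ ^ 2) / 2) := by
      refine (Complex.re_le_norm _).trans ?_
      simp only [dotProduct, Matrix.mulVec, Finset.mul_sum]
      refine (norm_sum_le _ _).trans (Finset.sum_le_sum fun i _ => ?_)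
      refine (norm_sum_le _ _).trans (Finset.sum_le_sum fun j _ => ?_)
      rw [norm_mul, norm_mul, Pi.star_apply, norm_star]
      nlinarith [mul_nonneg (norm_nonneg (H i j)) (sq_nonneg (‖x i‖ - ‖x j‖))]
    have h2 : (star x ⬝ᵥ (Matrix.diagonal (fun j => ((∑ i, ‖H i j‖ : ℝ) : ℂ))).mulVec x).re =
        ∑ j, ∑ i, ‖H i j‖ * ‖x j‖ ^ 2 := by
      simp only [dotProduct, Matrix.mulVec_diagonal, Complex.re_sum]
      refine Finset.sum_congr rfl fun j _ => ?_
      rw [← Finset.sum_mul, Pi.star_apply, Complex.star_def, mul_left_comm,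
        ← Complex.normSq_eq_conj_mul_self,
        ← Complex.ofReal_mul, Complex.ofReal_re, Complex.normSq_eq_norm_sq]
    have h3 : ∑ i, ∑ j, ‖H i j‖ * ((‖x i‖ ^ 2 + ‖x j‖ ^ 2) / 2) =
        ∑ j, ∑ i, ‖H i j‖ * ‖x j‖ ^ 2 := by
      have h4 : ∑ i, ∑ j, ‖H i j‖ * ‖x i‖ ^ 2 = ∑ j, ∑ i, ‖H i j‖ * ‖x j‖ ^ 2 :=
        Finset.sum_congr rfl fun i _ => Finset.sum_congr rfl fun j _ => by rw [hsymm]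
      have h5 : ∑ i, ∑ j, ‖H i j‖ * ‖x j‖ ^ 2 = ∑ j, ∑ i, ‖H i j‖ * ‖x j‖ ^ 2 := Finset.sum_comm
      have h6 : ∑ i, ∑ j, ‖H i j‖ * ((‖x i‖ ^ 2 + ‖x j‖ ^ 2) / 2) =
          (∑ i, ∑ j, ‖H i j‖ * ‖x i‖ ^ 2 + ∑ i, ∑ j, ‖H i j‖ * ‖x j‖ ^ 2) / 2 := by
        rw [← Finset.sum_add_distrib, Finset.sum_div]
        refine Finset.sum_congr rfl fun i _ => ?_
        rw [← Finset.sum_add_distrib, Finset.sum_div]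
        exact Finset.sum_congr rfl fun j _ => by ring
      rw [h6, h4, h5]
      ring
    rw [h2, ← h3]
    exact h1
  exact Complex.nonneg_iff.2 ⟨hre, him.symm⟩

/-- Add to the diagonal the one that dominates `σ' - σ`. This is the Lipschitz estimate behind
continuity. -/
theorem add_sum_norm_sub_mem_dominationSet {σ σ' : Op D} (hσ : σ.IsHermitian)
    (hσ' : σ'.IsHermitian) {s : ℝ} (hs : s ∈ dominationSet σ) :
    s + ∑ j, ∑ i, ‖σ' i j - σ i j‖ ∈ dominationSet σ' := by
  obtain ⟨d, hd, hsum⟩ := hs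
  refine ⟨fun j => d j + ∑ i, ‖σ' i j - σ i j‖, ?_, ?_⟩
  · have h := hd.add (posSemidef_diagonal_sum_norm_sub (hσ'.sub hσ))
    convert h using 1
    ext i j
    by_cases hij : i = j
    · subst hij
      simp
      ring
    · simp [hij]
      ring
  · rw [Finset.sum_add_distrib, hsum]
    ring

theorem sum_norm_sub_one_mem_dominationSet {σ : Op D} (hσ : σ.IsHermitian) :
    ∑ j, ∑ i, ‖σ i j‖ - 1 ∈ dominationSet σ := by
  -- The zero matrix dominates itself with trace `0 = 1 + (-1)`.
  have h0 : (-1 : ℝ) ∈ dominationSet (0 : Op D) :=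
    ⟨fun _ => 0, by simpa using Matrix.PosSemidef.zero, by simp⟩
  have h := add_sum_norm_sub_mem_dominationSet Matrix.isHermitian_zero hσ h0
  simpa [sub_eq_add_neg, add_comm] using h

theorem dominationSet_nonempty {σ : Op D} (hσ : σ ∈ states D) : (dominationSet σ).Nonempty :=
  ⟨_, sum_norm_sub_one_mem_dominationSet hσ.1.isHermitian⟩

theorem convexCombination_mem_dominationSet {σ τ : Op D} {s t a b : ℝ} (ha : 0 ≤ a) (hb : 0 ≤ b)
    (hab : a + b = 1) (hs : s ∈ dominationSet σ) (ht : t ∈ dominationSet τ) :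
    a * s + b * t ∈ dominationSet (a • σ + b • τ) := by
  obtain ⟨d, hd, hds⟩ := hs
  obtain ⟨e, he, het⟩ := ht
  refine ⟨fun j => a * d j + b * e j, ?_, ?_⟩
  · have h := (hd.smul ha).add (he.smul hb)
    convert h using 1
    ext i j
    by_cases hij : i = j
    · subst hij
      simp
      ring
    · simp [hij]
      ring
  · rw [Finset.sum_add_distrib, ← Finset.mul_sum, ← Finset.mul_sum, hds, het]
    linear_combination hab

theorem sInf_dominationSet_le_add {σ σ' : Op D} (hσ : σ ∈ states D) (hσ' : σ' ∈ states D) :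
    sInf (dominationSet σ') ≤ sInf (dominationSet σ) + ∑ j, ∑ i, ‖σ' i j - σ i j‖ := by
  rw [← sub_le_iff_le_add]
  refine le_csInf (dominationSet_nonempty hσ) fun s hs => ?_
  rw [sub_le_iff_le_add]
  exact csInf_le (bddBelow_dominationSet hσ')
    (add_sum_norm_sub_mem_dominationSet hσ.1.isHermitian hσ'.1.isHermitian hs)

/-- A state is a Gram matrix. -/
theorem exists_gram_of_mem_states {σ : Op D} (hσ : σ ∈ states D) :
    ∃ b : Fin D → EuclideanSpace ℂ (Fin D), (∀ i j, σ i j = inner ℂ (b i) (b j)) ∧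
      ∑ i, ‖b i‖ ^ 2 = 1 := by
  obtain ⟨B, rfl⟩ := hσ.1.exists_eq_conjTranspose_mul_self
  have hB : ∀ i j, (B.conjTranspose * B) i j =
      inner ℂ (WithLp.toLp 2 (B.col i)) (WithLp.toLp 2 (B.col j)) := fun i j => by
    rw [EuclideanSpace.inner_eq_star_dotProduct, dotProduct_comm]
    rfl
  refine ⟨fun i => WithLp.toLp 2 (B.col i), hB, ?_⟩
  have h := hσ.2
  rw [Matrix.trace] at h
  simp only [Matrix.diag, hB, inner_self_eq_norm_sq_to_K] at h
  exact Complex.ofReal_injective (by simpa using h)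

theorem sum_norm_gram_le {ι E : Type*} [Fintype ι] [NormedAddCommGroup E] [InnerProductSpace ℂ E]
    (b : ι → E) : ∑ j, ∑ i, ‖inner ℂ (b i) (b j)‖ ≤ (∑ i, ‖b i‖) ^ 2 := by
  rw [sq, Finset.sum_mul_sum, Finset.sum_comm]
  exact Finset.sum_le_sum fun i _ => Finset.sum_le_sum fun j _ => norm_inner_le_norm _ _

theorem sum_norm_le_of_mem_states {σ : Op D} (hσ : σ ∈ states D) : ∑ j, ∑ i, ‖σ i j‖ ≤ D := by
  obtain ⟨b, hb, hb1⟩ := exists_gram_of_mem_states hσ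
  simp only [hb]
  refine (sum_norm_gram_le b).trans ?_
  have := sq_sum_le_card_mul_sum_sq (s := Finset.univ) (f := fun i => ‖b i‖)
  rw [hb1] at this
  simpa using this

/-- A state whose entries have absolute sum `D` is a maximally coherent state. -/
theorem exists_phases_of_le_sum_norm (hD : 0 < D) {σ : Op D} (hσ : σ ∈ states D)
    (h : (D : ℝ) ≤ ∑ j, ∑ i, ‖σ i j‖) :
    ∃ α : Fin D → ℝ, ∀ i j, σ i j = (D : ℂ)⁻¹ * (Complex.exp ((α i : ℂ) * Complex.I) *
      star (Complex.exp ((α j : ℂ) * Complex.I))) := by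
  obtain ⟨b, hb, hb1⟩ := exists_gram_of_mem_states hσ
  simp only [hb] at h
  have hD' : (0 : ℝ) < D := by exact_mod_cast hD
  -- The bounds `∑ ‖⟨b i, b j⟩‖ ≤ (∑ ‖b i‖)² ≤ D ∑ ‖b i‖² = D` are now equalities: the Gram vectors
  -- have equal norms and are pairwise parallel.
  have hsq : (∑ i, ‖b i‖) ^ 2 = D := by
    refine le_antisymm ?_ (h.trans (sum_norm_gram_le b))
    have := sq_sum_le_card_mul_sum_sq (s := Finset.univ) (f := fun i => ‖b i‖)
    rw [hb1] at this
    simpa using this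
  have hsum : ∑ i, ‖b i‖ = Real.sqrt D := by
    rw [← hsq, Real.sqrt_sq (Finset.sum_nonneg fun i _ => norm_nonneg _)]
  have hnorm : ∀ i, ‖b i‖ = (Real.sqrt D)⁻¹ := by
    have hs : Real.sqrt D ≠ 0 := (Real.sqrt_pos.2 hD').ne'
    have h0 : ∑ i, (‖b i‖ - (Real.sqrt D)⁻¹) ^ 2 = 0 := by
      simp only [sub_sq, Finset.sum_add_distrib, Finset.sum_sub_distrib, ← Finset.sum_mul,
        ← Finset.mul_sum, hsum, hb1, Finset.sum_const, Finset.card_univ, Fintype.card_fin,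
        nsmul_eq_mul, inv_pow, Real.sq_sqrt hD'.le]
      rw [mul_assoc, mul_inv_cancel₀ hs, mul_inv_cancel₀ hD'.ne']
      norm_num
    intro i
    have := (Finset.sum_eq_zero_iff_of_nonneg fun _ _ => sq_nonneg _).1 h0 i (Finset.mem_univ i)
    exact sub_eq_zero.1 (pow_eq_zero_iff two_ne_zero |>.1 this)
  have hpos : ∀ i, b i ≠ 0 := fun i hi => by
    have := hnorm i
    rw [hi, norm_zero] at this
    exact (inv_pos.2 (Real.sqrt_pos.2 hD')).ne this
  have heq : ∀ i j, ‖inner ℂ (b i) (b j)‖ = ‖b i‖ * ‖b j‖ := by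
    have h1 : ∑ j, ∑ i, (‖b i‖ * ‖b j‖ - ‖inner ℂ (b i) (b j)‖) ≤ 0 := by
      simp only [Finset.sum_sub_distrib]
      rw [Finset.sum_comm, ← Finset.sum_mul_sum, ← sq, hsq]
      linarith
    have hnn : ∀ i j, 0 ≤ ‖b i‖ * ‖b j‖ - ‖inner ℂ (b i) (b j)‖ := fun i j =>
      sub_nonneg.2 (norm_inner_le_norm _ _)
    have h2 := le_antisymm h1 (Finset.sum_nonneg fun j _ => Finset.sum_nonneg fun i _ => hnn i j)
    intro i j
    have h3 := (Finset.sum_eq_zero_iff_of_nonneg fun j _ => Finset.sum_nonneg fun i _ => hnn i j).1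
      h2 j (Finset.mem_univ j)
    have h4 := (Finset.sum_eq_zero_iff_of_nonneg fun i _ => hnn i j).1 h3 i (Finset.mem_univ i)
    linarith
  let z : Fin D := ⟨0, hD⟩
  have hr : ∀ i, ∃ r : ℂ, r ≠ 0 ∧ b i = r • b z := fun i =>
    (norm_inner_eq_norm_iff (hpos z) (hpos i)).1 (heq z i)
  choose r _ hr using hr
  have hr1 : ∀ i, ‖r i‖ = 1 := fun i => by
    have h1 := congrArg norm (hr i)
    rw [norm_smul, hnorm, hnorm] at h1
    have hs : (Real.sqrt D)⁻¹ ≠ 0 := inv_ne_zero (Real.sqrt_pos.2 hD').ne'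
    exact (mul_eq_right₀ hs).1 h1.symm
  -- The inner product is conjugate-linear on the left, so the phase of row `i` is that of `star (r
  -- i)`.
  refine ⟨fun i => (star (r i)).arg, fun i j => ?_⟩
  have hexp : ∀ i, Complex.exp (((star (r i)).arg : ℂ) * Complex.I) = star (r i) := fun i => by
    have := Complex.norm_mul_exp_arg_mul_I (star (r i))
    rwa [norm_star, hr1, Complex.ofReal_one, one_mul] at this
  have hbz : inner ℂ (b z) (b z) = (D : ℂ)⁻¹ := by
    rw [inner_self_eq_norm_sq_to_K, hnorm, ← RCLike.ofReal_pow, inv_pow, Real.sq_sqrt hD'.le]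
    simp
  rw [hb, hexp, hexp, star_star, hr i, hr j, inner_smul_left, inner_smul_right, hbz,
    Complex.star_def]
  ring

end Domination

/-! ### The robustness of coherence satisfies the axioms -/

section Robustness

open scoped ComplexOrder

variable {D : ℕ}

theorem conjTranspose_mul_self_uni (U : Uni D) : (U : Op D).conjTranspose * (U : Op D) = 1 :=
  Matrix.mem_unitaryGroup_iff'.1 U.2

theorem self_mul_conjTranspose_uni (U : Uni D) : (U : Op D) * (U : Op D).conjTranspose = 1 :=
  Matrix.mem_unitaryGroup_iff.1 U.2

/-- The matrix of the operator `ρ` in the basis `U |j⟩`. -/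
def inBasis (U : Uni D) (ρ : Op D) : Op D := (U : Op D).conjTranspose * ρ * (U : Op D)

theorem mul_inBasis_mul (U : Uni D) (ρ : Op D) :
    (U : Op D) * inBasis U ρ * (U : Op D).conjTranspose = ρ := by
  rw [inBasis, ← Matrix.mul_assoc, ← Matrix.mul_assoc, self_mul_conjTranspose_uni, Matrix.one_mul,
    Matrix.mul_assoc, self_mul_conjTranspose_uni, Matrix.mul_one]

theorem inBasis_mul_mul (U : Uni D) (σ : Op D) :
    inBasis U ((U : Op D) * σ * (U : Op D).conjTranspose) = σ := by
  rw [inBasis, Matrix.mul_assoc, Matrix.mul_assoc, conjTranspose_mul_self_uni, Matrix.mul_one,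
    ← Matrix.mul_assoc, conjTranspose_mul_self_uni, Matrix.one_mul]

theorem inBasis_injective (U : Uni D) : Function.Injective (inBasis U) := fun ρ σ h => by
  rw [← mul_inBasis_mul U ρ, h, mul_inBasis_mul]

theorem inBasis_add (U : Uni D) (ρ σ : Op D) : inBasis U (ρ + σ) = inBasis U ρ + inBasis U σ := by
  rw [inBasis, Matrix.mul_add, Matrix.add_mul, inBasis, inBasis]

theorem inBasis_smul (U : Uni D) (a : ℝ) (ρ : Op D) : inBasis U (a • ρ) = a • inBasis U ρ := by
  rw [inBasis, Matrix.mul_smul, Matrix.smul_mul, inBasis]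

theorem trace_inBasis (U : Uni D) (ρ : Op D) : (inBasis U ρ).trace = ρ.trace := by
  rw [inBasis, Matrix.trace_mul_comm, ← Matrix.mul_assoc, self_mul_conjTranspose_uni,
    Matrix.one_mul]

theorem inBasis_mem_states (U : Uni D) {ρ : Op D} (hρ : ρ ∈ states D) : inBasis U ρ ∈ states D :=
  ⟨hρ.1.conjTranspose_mul_mul_same _, (trace_inBasis U ρ).trans hρ.2⟩

theorem continuous_inBasis (U : Uni D) : Continuous (inBasis U) := by
  unfold inBasis
  fun_prop

theorem smul_add_smul_mem_states {ρ τ : Op D} (hρ : ρ ∈ states D) (hτ : τ ∈ states D) {a b : ℝ}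
    (ha : 0 ≤ a) (hb : 0 ≤ b) (hab : a + b = 1) : a • ρ + b • τ ∈ states D := by
  refine ⟨(hρ.1.smul ha).add (hτ.1.smul hb), ?_⟩
  rw [Matrix.trace_add, Matrix.trace_smul, Matrix.trace_smul, hρ.2, hτ.2, ← add_smul, hab, one_smul]

/-- In the basis `U`, mixing to a diagonal state means that `s • τ` equals `δ - ρ` for a diagonal
`δ` of trace `1 + s`; conversely, a positive `δ - ρ` of trace `s > 0` rescales to a state. -/
theorem setOf_mixing_eq_dominationSet (U : Uni D) {ρ : Op D} (hρ : ρ ∈ states D) :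
    {s : ℝ | 0 ≤ s ∧ ∃ τ ∈ states D, (1 + s)⁻¹ • (ρ + s • τ) ∈ incoherent U} =
      dominationSet (inBasis U ρ) := by
  ext s
  constructor
  · rintro ⟨hs, τ, hτ, hmem⟩
    have hs1 : (1 + s) ≠ 0 := by positivity
    have hdiag : (inBasis U ((1 + s)⁻¹ • (ρ + s • τ))).IsDiag := hmem.2
    have hherm := (inBasis_mem_states U hmem.1).1.isHermitian
    set δ := inBasis U ((1 + s)⁻¹ • (ρ + s • τ)) with hδ
    have hsum : inBasis U ρ + s • inBasis U τ = (1 + s) • δ := by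
      rw [hδ, inBasis_smul, smul_smul, mul_inv_cancel₀ hs1, one_smul, inBasis_add, inBasis_smul]
    have hd : Matrix.diagonal (fun j => (((1 + s) * (δ j j).re : ℝ) : ℂ)) = (1 + s) • δ := by
      ext i j
      by_cases hij : i = j
      · subst hij
        have him : (δ i i).im = 0 := by
          have := hherm.apply i i
          exact Complex.conj_eq_iff_im.1 this
        rw [Matrix.diagonal_apply_eq, Matrix.smul_apply]
        apply Complex.ext <;> simp [him]
      · rw [Matrix.diagonal_apply_ne _ hij, Matrix.smul_apply, hdiag hij, smul_zero]
    refine ⟨fun j => (1 + s) * (δ j j).re, ?_, ?_⟩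
    · rw [hd, ← hsum, add_sub_cancel_left]
      exact (inBasis_mem_states U hτ).1.smul hs
    · have ht := (inBasis_mem_states U hmem.1).2
      rw [← Finset.mul_sum, ← Complex.re_sum]
      have : ∑ j, δ j j = 1 := ht
      rw [this, Complex.one_re, mul_one]
  · intro hs
    have hs0 := nonneg_of_mem_dominationSet (inBasis_mem_states U hρ) hs
    obtain ⟨d, hd, hsum⟩ := hs
    refine ⟨hs0, ?_⟩
    set δ : Op D := Matrix.diagonal (fun j => (d j : ℂ)) with hδ
    have htr : (δ - inBasis U ρ).trace = (s : ℂ) := by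
      rw [hδ, trace_diagonal_ofReal_sub, hsum, trace_inBasis, hρ.2]
      simp
    obtain ⟨τ, hτ, hτs⟩ : ∃ τ ∈ states D, δ = inBasis U ρ + s • inBasis U τ := by
      -- For `s = 0` the positive difference has trace zero, so it vanishes and `τ` is arbitrary.
      rcases hs0.eq_or_lt with rfl | hpos
      · refine ⟨ρ, hρ, ?_⟩
        rw [zero_smul, add_zero, ← sub_eq_zero]
        exact hd.trace_eq_zero_iff.1 (by simpa using htr)
      · have hmem : s⁻¹ • (δ - inBasis U ρ) ∈ states D := by
          refine ⟨hd.smul (inv_nonneg.2 hs0), ?_⟩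
          rw [Matrix.trace_smul, htr, Complex.real_smul, ← Complex.ofReal_mul,
            inv_mul_cancel₀ hpos.ne', Complex.ofReal_one]
        refine ⟨(U : Op D) * (s⁻¹ • (δ - inBasis U ρ)) * (U : Op D).conjTranspose, ?_, ?_⟩
        · refine ⟨hmem.1.mul_mul_conjTranspose_same _, ?_⟩
          rw [← trace_inBasis U, inBasis_mul_mul]
          exact hmem.2
        · rw [inBasis_mul_mul, smul_smul, mul_inv_cancel₀ hpos.ne', one_smul, add_sub_cancel]
    refine ⟨τ, hτ, ?_, ?_⟩
    · rw [smul_add, smul_smul]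
      have hs1 : 0 < 1 + s := by positivity
      refine smul_add_smul_mem_states hρ hτ (inv_nonneg.2 hs1.le) (by positivity) ?_
      field_simp
    · change (inBasis U _).IsDiag
      rw [inBasis_smul, inBasis_add, inBasis_smul, ← hτs]
      exact (Matrix.isDiag_diagonal _).smul _

theorem robustness_eq (U : Uni D) {ρ : Op D} (hρ : ρ ∈ states D) :
    robustness U ρ = 1 / ((D : ℝ) - 1) * sInf (dominationSet (inBasis U ρ)) := by
  rw [robustness, setOf_mixing_eq_dominationSet U hρ]

theorem inBasis_maxCoh_apply (U : Uni D) (α : Fin D → ℝ) (i j : Fin D) :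
    inBasis U (maxCoh U α) i j = (D : ℂ)⁻¹ * (Complex.exp ((α i : ℂ) * Complex.I) *
      star (Complex.exp ((α j : ℂ) * Complex.I))) := by
  have hs : ((Real.sqrt D : ℝ) : ℂ) * ((Real.sqrt D : ℝ) : ℂ) = D := by
    rw [← Complex.ofReal_mul, Real.mul_self_sqrt (Nat.cast_nonneg D), Complex.ofReal_natCast]
  have h := mul_vecMulVec_mul_conjTranspose (U : Op D).conjTranspose (maxCohVec U α)
  rw [Matrix.conjTranspose_conjTranspose] at h
  rw [inBasis, maxCoh, h, maxCohVec, Matrix.mulVec_smul, Matrix.mulVec_mulVec,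
    conjTranspose_mul_self_uni, Matrix.one_mulVec, ← hs]
  simp only [Matrix.vecMulVec_apply, Pi.smul_apply, Pi.star_apply, smul_eq_mul, star_mul',
    star_inv₀, Complex.star_def, Complex.conj_ofReal, mul_inv]
  ring

/-- Test the domination on the vector `x` of phases: the diagonal matrix gives its trace `1 + s`,
while `x` is an eigenvector of the state with eigenvalue 1 and squared norm `D`. -/
theorem le_of_mem_dominationSet_maxCoh (hD : 0 < D) (U : Uni D) (α : Fin D → ℝ) {s : ℝ}
    (hs : s ∈ dominationSet (inBasis U (maxCoh U α))) : (D : ℝ) - 1 ≤ s := by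
  obtain ⟨d, hd, hsum⟩ := hs
  have hD0 : (D : ℂ) ≠ 0 := by exact_mod_cast hD.ne'
  set x : Fin D → ℂ := fun j => Complex.exp ((α j : ℂ) * Complex.I) with hx
  have hxx : ∀ j, star (x j) * x j = 1 := fun j => by
    rw [hx, Complex.star_def, mul_comm, Complex.mul_conj, Complex.normSq_eq_norm_sq,
      Complex.norm_exp_ofReal_mul_I]
    simp
  have h := hd.dotProduct_mulVec_nonneg x
  have h1 : star x ⬝ᵥ (Matrix.diagonal fun j => (d j : ℂ)).mulVec x = ((1 + s : ℝ) : ℂ) := by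
    rw [← hsum, Complex.ofReal_sum]
    simp only [dotProduct, Matrix.mulVec_diagonal, Pi.star_apply]
    exact Finset.sum_congr rfl fun j _ => by rw [mul_left_comm, hxx, mul_one]
  have h2 : star x ⬝ᵥ (inBasis U (maxCoh U α)).mulVec x = (D : ℂ) := by
    have h3 : ∀ i, (inBasis U (maxCoh U α)).mulVec x i = x i := fun i => by
      have : ∀ j, inBasis U (maxCoh U α) i j * x j = (D : ℂ)⁻¹ * x i := fun j => by
        rw [inBasis_maxCoh_apply]
        linear_combination (D : ℂ)⁻¹ * x i * hxx j
      simp only [Matrix.mulVec, dotProduct, this]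
      rw [Finset.sum_const, Finset.card_univ, Fintype.card_fin, nsmul_eq_mul, ← mul_assoc,
        mul_inv_cancel₀ hD0, one_mul]
    simp only [dotProduct, h3, Pi.star_apply, hxx]
    simp
  rw [Matrix.sub_mulVec, dotProduct_sub, h1, h2, ← Complex.ofReal_natCast, ← Complex.ofReal_sub,
    Complex.zero_le_real] at h
  linarith

/-- The normalized robustness of coherence is a coherence measure. -/
theorem isCoherenceMeasure_robustness (hD : 2 ≤ D) :
    IsCoherenceMeasure (robustness : Uni D → Op D → ℝ) := by
  have hD0 : 0 < D := by omega
  have hD1 : (0 : ℝ) < (D : ℝ) - 1 := by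
    have : (2 : ℝ) ≤ D := by exact_mod_cast hD
    linarith
  have hle : ∀ (U : Uni D), ∀ ρ ∈ states D,
      sInf (dominationSet (inBasis U ρ)) ≤ ∑ j, ∑ i, ‖inBasis U ρ i j‖ - 1 := fun U ρ hρ =>
    csInf_le (bddBelow_dominationSet (inBasis_mem_states U hρ))
      (sum_norm_sub_one_mem_dominationSet (inBasis_mem_states U hρ).1.isHermitian)
  have hupper : ∀ (U : Uni D), ∀ ρ ∈ states D,
      sInf (dominationSet (inBasis U ρ)) ≤ (D : ℝ) - 1 := fun U ρ hρ =>
    (hle U ρ hρ).trans (sub_le_sub_right (sum_norm_le_of_mem_states (inBasis_mem_states U hρ)) 1)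
  refine ⟨fun U ρ hρ => ?_, fun U => ?_, fun U => ⟨?_, ?_⟩, fun U ρ hρ => ⟨fun h => ?_, ?_⟩⟩
  · rw [robustness_eq U hρ, one_div_mul_eq_div]
    refine ⟨div_nonneg (Real.sInf_nonneg fun s hs =>
      nonneg_of_mem_dominationSet (inBasis_mem_states U hρ) hs) hD1.le, ?_⟩
    rw [div_le_one hD1]
    exact hupper U ρ hρ
  · have hcont : ContinuousOn (fun ρ => sInf (dominationSet (inBasis U ρ))) (states D) := by
      intro ρ hρ
      rw [ContinuousWithinAt, tendsto_iff_dist_tendsto_zero]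
      refine squeeze_zero' (g := fun σ => ∑ j, ∑ i, ‖inBasis U σ i j - inBasis U ρ i j‖)
        (Filter.Eventually.of_forall fun _ => dist_nonneg) ?_ ?_
      · filter_upwards [self_mem_nhdsWithin] with σ hσ
        have h1 := sInf_dominationSet_le_add (inBasis_mem_states U hρ) (inBasis_mem_states U hσ)
        have h2 := sInf_dominationSet_le_add (inBasis_mem_states U hσ) (inBasis_mem_states U hρ)
        simp only [fun i j => norm_sub_rev (inBasis U ρ i j) (inBasis U σ i j)] at h2
        rw [Real.dist_eq, abs_sub_le_iff]
        constructor <;> linarith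
      · have hc : Continuous fun σ => ∑ j, ∑ i, ‖inBasis U σ i j - inBasis U ρ i j‖ := by
          have := continuous_inBasis U
          refine continuous_finsetSum _ fun j _ => continuous_finsetSum _ fun i _ => ?_
          exact ((this.matrix_elem i j).sub continuous_const).norm
        have h := (hc.tendsto ρ).mono_left (nhdsWithin_le_nhds (s := states D))
        simpa using h
    exact (continuousOn_const.mul hcont).congr fun ρ hρ => robustness_eq U hρ
  · intro ρ hρ τ hτ a b ha hb hab
    exact smul_add_smul_mem_states hρ hτ ha hb hab
  · intro ρ hρ τ hτ a b ha hb hab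
    rw [robustness_eq U hρ, robustness_eq U hτ,
      robustness_eq U (smul_add_smul_mem_states hρ hτ ha hb hab), inBasis_add, inBasis_smul,
      inBasis_smul]
    have hρ' := inBasis_mem_states U hρ
    have hτ' := inBasis_mem_states U hτ
    have key : sInf (dominationSet (a • inBasis U ρ + b • inBasis U τ)) ≤
        a * sInf (dominationSet (inBasis U ρ)) + b * sInf (dominationSet (inBasis U τ)) := by
      refine le_of_forall_pos_le_add fun ε hε => ?_
      obtain ⟨s, hs, hsε⟩ := Real.lt_sInf_add_pos (dominationSet_nonempty hρ') hε
      obtain ⟨t, ht, htε⟩ := Real.lt_sInf_add_pos (dominationSet_nonempty hτ') hε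
      refine (csInf_le (bddBelow_dominationSet (smul_add_smul_mem_states hρ' hτ' ha hb hab))
        (convexCombination_mem_dominationSet ha hb hab hs ht)).trans ?_
      have h1 := mul_le_mul_of_nonneg_left hsε.le ha
      have h2 := mul_le_mul_of_nonneg_left htε.le hb
      have h3 : a * ε + b * ε = ε := by rw [← add_mul, hab, one_mul]
      linarith
    refine (mul_le_mul_of_nonneg_left key (one_div_nonneg.2 hD1.le)).trans (le_of_eq ?_)
    simp only [smul_eq_mul]
    ring
  -- Robustness 1 forces the absolute sum of the entries up to its maximum `D`, the equality case of
  -- `exists_phases_of_le_sum_norm`.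
  · rw [robustness_eq U hρ, one_div_mul_eq_div, div_eq_one_iff_eq hD1.ne'] at h
    have hρ' := inBasis_mem_states U hρ
    have h1 := hle U ρ hρ
    obtain ⟨α, hα⟩ := exists_phases_of_le_sum_norm hD0 hρ' (by linarith)
    refine ⟨α, inBasis_injective U ?_⟩
    ext i j
    rw [hα, inBasis_maxCoh_apply]
  · rintro ⟨α, rfl⟩
    rw [robustness_eq U hρ, one_div_mul_eq_div, div_eq_one_iff_eq hD1.ne']
    exact le_antisymm (hupper U _ hρ) (le_csInf (dominationSet_nonempty (inBasis_mem_states U hρ))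
      fun s hs => le_of_mem_dominationSet_maxCoh hD0 U α hs)

end Robustness

end QuantumMemory

theorem theorem6 (D : ℕ) (hD : 2 ≤ D) (M : QuantumMemory.Channel D) :
    ((QuantumMemory.Qminus QuantumMemory.robustness M = 1 ∨
        QuantumMemory.Qzero QuantumMemory.robustness M = 1 ∨
        QuantumMemory.Qplus QuantumMemory.robustness M = 1) → M.IsUnitary) ∧
    (∀ C : QuantumMemory.Uni D → QuantumMemory.Op D → ℝ, QuantumMemory.IsCoherenceMeasure C →
      (QuantumMemory.Qminus C M = 1 ∨ QuantumMemory.Qzero C M = 1 ∨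
        QuantumMemory.Qplus C M = 1) → M.IsUnitary) :=
  ⟨(QuantumMemory.isCoherenceMeasure_robustness hD).isUnitary hD M,
    fun _ hC => hC.isUnitary hD M⟩
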